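/- Let $\mathcal{A}$ be a complex Banach algebra with identity $1$, and let $\sigma(b)$ denote the spectrum of $b\in\mathcal{A}$. An element $b\in\mathcal{A}$ is called quasinilpotent if $\sigma(b)=\{0\}$. An element $a\in\mathcal{A}$ is called - *generalized Drazin invertible* if there is $x\in\mathcal{A}$ with $ax=xa$, $xax=x$ and $a-a^2x$ quasinilpotent; - *eg-Drazin invertible* if there is $x\in\mathcal{A}$ with $ax=xa$, $xax=x$ and $a-a^2x$ generalized Drazin invertible. Let $\mathcal{A}^{acc}$ be the set of all $b\in\mathcal{A}$ such that $b-\lambda 1$ is generalized Drazin invertible for every $\lambda\in\mathbb{C}\setminus\{0\}$. An *ag-Drazin inverse* of $a$ is an element $x\in\mathcal{A}$ with $ax=xa$, $xax=x$ and $a-a^2x\in\mathcal{A}^{acc}$; the element $a$ is *ag-Drazin invertible* if it has an ag-Drazin inverse. For every $a\in\mathcal{A}$ the following statements are equivalent: 1. $a$ is ag-Drazin invertible and it has some ag-Drazin inverse $x$ for which the spectrum $\sigma(a-a^2x)$ is a finite set; 2. $a$ is eg-Drazin invertible; 3. $a$ is generalized Drazin invertible. -/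

import Mathlib

/-- `a` is quasinilpotent: its spectrum is exactly `{0}`. -/
def IsQuasinilpotentElem {A : Type*} [NormedRing A] [NormedAlgebra ℂ A] (a : A) : Prop :=
  spectrum ℂ a = {0}

/-- `x` is a generalized Drazin inverse of `a`. -/
structure IsGDrazinInverse {A : Type*} [NormedRing A] [NormedAlgebra ℂ A] (a x : A) : Prop where
  comm : a * x = x * a
  outer : x * a * x = x
  qnil : IsQuasinilpotentElem (a - a ^ 2 * x)

/-- `a` is generalized Drazin invertible. -/
def IsGDrazinInvertible {A : Type*} [NormedRing A] [NormedAlgebra ℂ A] (a : A) : Prop :=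
  ∃ x : A, IsGDrazinInverse a x

/-- `x` is an extended generalized Drazin (eg-Drazin) inverse of `a`. -/
structure IsEGDrazinInverse {A : Type*} [NormedRing A] [NormedAlgebra ℂ A] (a x : A) : Prop where
  comm : a * x = x * a
  outer : x * a * x = x
  gDrazin : IsGDrazinInvertible (a - a ^ 2 * x)

/-- `a` is eg-Drazin invertible. -/
def IsEGDrazinInvertible {A : Type*} [NormedRing A] [NormedAlgebra ℂ A] (a : A) : Prop :=
  ∃ x : A, IsEGDrazinInverse a x

/-- The class `A^acc`: `a - λ1` is generalized Drazin invertible for every nonzero `λ`. -/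
def IsAccElem {A : Type*} [NormedRing A] [NormedAlgebra ℂ A] (a : A) : Prop :=
  ∀ z : ℂ, z ≠ 0 → IsGDrazinInvertible (a - algebraMap ℂ A z)

/-- `x` is an ag-Drazin inverse of `a`. -/
structure IsAGDrazinInverse {A : Type*} [NormedRing A] [NormedAlgebra ℂ A] (a x : A) : Prop where
  comm : a * x = x * a
  outer : x * a * x = x
  acc : IsAccElem (a - a ^ 2 * x)

section

variable {A : Type*} [NormedRing A] [NormedAlgebra ℂ A]

/-! Only 1 → 2 has analytic content: an element `b` of `A^acc` with finite spectrum is generalized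
Drazin invertible. Induct on the nonzero spectral points. For such a point `l`, the generalized
Drazin inverse `y` of `d = b - l` gives an idempotent `p = d * y` commuting with `b`. On `1 - p`,
`b` is `l` plus a quasinilpotent, hence invertible; on `p`, `b - l` is invertible, so `b * p` has
lost the point `l`. It remains in `A^acc` because generalized Drazin inverses lie in the double
commutant. The two pieces are glued by 2 → 3, where the two inverses annihilate each other and their
sum works. For 3 → 1, the same `x` serves. -/

theorem IsQuasinilpotentElem.nontrivial {a : A} (h : IsQuasinilpotentElem a) : Nontrivial A := by
  by_contra hA
  rw [not_nontrivial_iff_subsingleton] at hA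
  have h0 : (0 : ℂ) ∈ spectrum ℂ a := by rw [h]; rfl
  exact h0 (isUnit_of_subsingleton _)

theorem IsQuasinilpotentElem.isUnit_sub {a : A} (h : IsQuasinilpotentElem a) {z : ℂ}
    (hz : z ≠ 0) : IsUnit (a - algebraMap ℂ A z) := by
  have : z ∉ spectrum ℂ a := by rw [h]; exact hz
  rw [spectrum.notMem_iff] at this
  simpa using this.neg

theorem isQuasinilpotentElem_of_isUnit_sub [CompleteSpace A] [Nontrivial A] {a : A}
    (h : ∀ z : ℂ, z ≠ 0 → IsUnit (a - algebraMap ℂ A z)) : IsQuasinilpotentElem a := by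
  refine (spectrum.nonempty a).subset_singleton_iff.1 fun z hz => ?_
  by_contra hz0
  exact hz (spectrum.mem_resolventSet_iff.2 (by simpa using (h z hz0).neg))

theorem isQuasinilpotentElem_zero [Nontrivial A] : IsQuasinilpotentElem (0 : A) :=
  spectrum.zero_eq

theorem IsQuasinilpotentElem.isGDrazinInvertible {a : A} (h : IsQuasinilpotentElem a) :
    IsGDrazinInvertible a :=
  ⟨0, by simp, by simp, by simpa using h⟩

theorem IsGDrazinInvertible.of_isUnit [Nontrivial A] {a : A} (h : IsUnit a) :
    IsGDrazinInvertible a := by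
  obtain ⟨u, rfl⟩ := h
  exact ⟨↑u⁻¹, by simp, by simp, by simpa [pow_two, mul_assoc] using isQuasinilpotentElem_zero⟩

theorem IsGDrazinInvertible.nontrivial {a : A} (h : IsGDrazinInvertible a) : Nontrivial A :=
  h.choose_spec.qnil.nontrivial

theorem IsQuasinilpotentElem.isAccElem {a : A} (h : IsQuasinilpotentElem a) : IsAccElem a :=
  have := h.nontrivial
  fun _ hz => .of_isUnit (h.isUnit_sub hz)

/-! ### Gluing inverses -/

theorem IsEGDrazinInverse.isGDrazinInvertible {a x : A} (h : IsEGDrazinInverse a x) :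
    IsGDrazinInvertible a := by
  obtain ⟨hc, ho, y, hyc, hyo, hq⟩ := h
  set b := a - a ^ 2 * x with hb
  have hbx : b * x = 0 := by
    have : a ^ 2 * x * x = a * x := by
      calc a ^ 2 * x * x = a * ((a * x) * x) := by noncomm_ring
        _ = a * (x * a * x) := by rw [hc]
        _ = a * x := by rw [ho]
    rw [hb, sub_mul, this, sub_self]
  have hxb : x * b = 0 := by
    have : x * b = b * x := by
      have h2 : x * (a ^ 2 * x) = a ^ 2 * x * x := by
        calc x * (a ^ 2 * x) = x * a * (a * x) := by noncomm_ring
          _ = a * x * (a * x) := by rw [hc]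
          _ = a * (x * a) * x := by noncomm_ring
          _ = a * (a * x) * x := by rw [hc]
          _ = a ^ 2 * x * x := by noncomm_ring
      rw [hb, mul_sub, sub_mul, h2, hc]
    rw [this, hbx]
  have hyx : y * x = 0 := by
    calc y * x = y * b * y * x := by rw [hyo]
      _ = y * (b * y) * x := by noncomm_ring
      _ = y * (y * b) * x := by rw [hyc]
      _ = y * y * (b * x) := by noncomm_ring
      _ = 0 := by rw [hbx, mul_zero]
  have hxy : x * y = 0 := by
    calc x * y = x * (y * b * y) := by rw [hyo]
      _ = x * (b * y * y) := by rw [hyc]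
      _ = x * b * y * y := by noncomm_ring
      _ = 0 := by rw [hxb]; simp
  have hay : a * y = b * y := by
    rw [hb, sub_mul, mul_assoc (a ^ 2), hxy]; simp
  have hya : y * a = y * b := by
    have : a ^ 2 * x = x * a ^ 2 := by
      rw [pow_two, mul_assoc, hc, ← mul_assoc, hc, mul_assoc]
    rw [hb, mul_sub, this, ← mul_assoc, hyx]; simp
  refine ⟨x + y, ?_, ?_, ?_⟩
  · rw [mul_add, add_mul, hay, hya, hc, hyc]
  · calc (x + y) * a * (x + y) = x * a * x + x * (a * y) + y * a * x + y * a * y := by noncomm_ring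
      _ = x * a * x + x * b * y + y * (b * x) + y * b * y := by rw [hay, hya]; noncomm_ring
      _ = x + y := by rw [ho, hxb, hbx, hyo]; simp
  · have : a - a ^ 2 * (x + y) = b - b ^ 2 * y := by
      calc a - a ^ 2 * (x + y) = b - a * (a * y) := by rw [hb]; noncomm_ring
        _ = b - b * y * b := by rw [hay, hyc, ← mul_assoc, hay, hyc]
        _ = b - b ^ 2 * y := by rw [mul_assoc, ← hyc, ← mul_assoc, pow_two]
    rw [this]; exact hq

/-! ### Gelfand's formula and the double commutant -/

theorem IsQuasinilpotentElem.tendsto_pow_mul_norm_pow [CompleteSpace A] {u : A}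
    (h : IsQuasinilpotentElem u) (K : ℝ) (hK : 0 ≤ K) :
    Filter.Tendsto (fun n : ℕ => K ^ n * ‖u ^ n‖) Filter.atTop (nhds 0) := by
  have hr : spectralRadius ℂ u = 0 := by
    unfold spectralRadius
    rw [show spectrum ℂ u = {0} from h]; simp
  have ht := spectrum.pow_norm_pow_one_div_tendsto_nhds_spectralRadius u
  rw [hr] at ht
  have hK1 : 0 < K + 1 := by linarith
  -- This threshold leaves a geometric bound of ratio `1 / 2`; `K + 1` avoids dividing by zero.
  have hev := ht.eventually_lt_const
    (show (0 : ENNReal) < ENNReal.ofReal (1 / (2 * (K + 1))) by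
      rw [ENNReal.ofReal_pos]; positivity)
  refine squeeze_zero' (.of_forall fun n => by positivity) ?_
    (tendsto_pow_atTop_nhds_zero_of_lt_one (r := (1 / 2 : ℝ)) (by norm_num) (by norm_num))
  filter_upwards [hev, Filter.eventually_ge_atTop 1] with n hn hn1
  rw [ENNReal.ofReal_lt_ofReal_iff (by positivity)] at hn
  have h1 : ‖u ^ n‖ ≤ (1 / (2 * (K + 1))) ^ n := by
    have := pow_le_pow_left₀ (by positivity) hn.le n
    rwa [one_div (n : ℝ), Real.rpow_inv_natCast_pow (norm_nonneg _) (by omega)] at this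
  calc K ^ n * ‖u ^ n‖ ≤ (K + 1) ^ n * (1 / (2 * (K + 1))) ^ n := by gcongr; linarith
    _ = (1 / 2) ^ n := by rw [← mul_pow]; congr 1; field_simp

/-- Iteration gives `c = y ^ n * c * u ^ n`, and `‖u ^ n‖` decays faster than any geometric growth
of `‖y ^ n‖`. -/
theorem eq_zero_of_eq_mul_mul [CompleteSpace A] {u y c : A} (h : IsQuasinilpotentElem u)
    (hc : c = y * c * u) : c = 0 := by
  have hn : ∀ n : ℕ, c = y ^ n * c * u ^ n := by
    intro n
    induction n with
    | zero => simp
    | succ n ih =>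
      calc c = y ^ n * (y * c * u) * u ^ n := by rw [← hc, ← ih]
        _ = y ^ (n + 1) * c * u ^ (n + 1) := by rw [pow_succ y, pow_succ' u]; noncomm_ring
  have ht := (h.tendsto_pow_mul_norm_pow ‖y‖ (norm_nonneg _)).const_mul ‖c‖
  rw [mul_zero] at ht
  refine norm_le_zero_iff.1 (ge_of_tendsto ht ?_)
  filter_upwards [Filter.eventually_ge_atTop 1] with n hn1
  calc ‖c‖ = ‖y ^ n * c * u ^ n‖ := by rw [← hn n]
    _ ≤ ‖y ^ n * c‖ * ‖u ^ n‖ := norm_mul_le _ _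
    _ ≤ ‖y ^ n‖ * ‖c‖ * ‖u ^ n‖ := by gcongr; exact norm_mul_le _ _
    _ ≤ ‖y‖ ^ n * ‖c‖ * ‖u ^ n‖ := by gcongr; exact norm_pow_le' y hn1
    _ = ‖c‖ * (‖y‖ ^ n * ‖u ^ n‖) := by ring

theorem eq_zero_of_eq_mul_mul' [CompleteSpace A] {u y c : A} (h : IsQuasinilpotentElem u)
    (hc : c = u * c * y) : c = 0 := by
  have hn : ∀ n : ℕ, c = u ^ n * c * y ^ n := by
    intro n
    induction n with
    | zero => simp
    | succ n ih =>
      calc c = u ^ n * (u * c * y) * y ^ n := by rw [← hc, ← ih]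
        _ = u ^ (n + 1) * c * y ^ (n + 1) := by rw [pow_succ u, pow_succ' y]; noncomm_ring
  have ht := (h.tendsto_pow_mul_norm_pow ‖y‖ (norm_nonneg _)).const_mul ‖c‖
  rw [mul_zero] at ht
  refine norm_le_zero_iff.1 (ge_of_tendsto ht ?_)
  filter_upwards [Filter.eventually_ge_atTop 1] with n hn1
  calc ‖c‖ = ‖u ^ n * c * y ^ n‖ := by rw [← hn n]
    _ ≤ ‖u ^ n * c‖ * ‖y ^ n‖ := norm_mul_le _ _
    _ ≤ ‖u ^ n‖ * ‖c‖ * ‖y‖ ^ n := by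
      gcongr
      exacts [norm_mul_le _ _, norm_pow_le' y hn1]
    _ = ‖c‖ * (‖y‖ ^ n * ‖u ^ n‖) := by ring

/-- A generalized Drazin inverse of `d` lies in the double commutant of `d`. -/
theorem IsGDrazinInverse.commute [CompleteSpace A] {d y c : A} (h : IsGDrazinInverse d y)
    (hc : Commute c d) : Commute c y := by
  obtain ⟨hdy, ho, hq⟩ := h
  have hcd : c * d = d * c := hc
  set p := d * y with hp
  have hpd : p * d = d * p := by rw [hp, mul_assoc, ← hdy]
  have hpp : p * p = p := by rw [hp, mul_assoc, ← mul_assoc y, ho]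
  have hu : d - d ^ 2 * y = d * (1 - p) := by rw [hp]; noncomm_ring
  have hu' : d * (1 - p) = (1 - p) * d := by rw [mul_sub, sub_mul, hpd]; simp
  rw [hu] at hq
  -- The off-diagonal corners of `c` vanish: `y` inverts `d` on `p`, while `d` is quasinilpotent on
  -- `1 - p`.
  have h1 : p * c * (1 - p) = 0 := by
    refine eq_zero_of_eq_mul_mul (y := y) hq ?_
    symm
    calc y * (p * c * (1 - p)) * (d * (1 - p))
        = y * p * c * ((1 - p) * d) * (1 - p) := by noncomm_ring
      _ = y * p * (c * d) * ((1 - p) * (1 - p)) := by rw [← hu']; noncomm_ring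
      _ = y * (p * d) * c * ((1 - p) * (1 - p)) := by rw [hcd]; noncomm_ring
      _ = (y * d) * p * c * (1 - p - p + p * p) := by rw [hpd]; noncomm_ring
      _ = p * c * (1 - p) := by rw [← hdy, hpp]; noncomm_ring
  have h2 : (1 - p) * c * p = 0 := by
    refine eq_zero_of_eq_mul_mul' (y := y) hq ?_
    symm
    calc d * (1 - p) * ((1 - p) * c * p) * y
        = d * (1 - p - p + p * p) * c * p * y := by noncomm_ring
      _ = d * (1 - p) * c * p * y := by rw [hpp]; noncomm_ring
      _ = (1 - p) * (d * c) * p * y := by rw [hu']; noncomm_ring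
      _ = (1 - p) * c * (d * p) * y := by rw [← hcd]; noncomm_ring
      _ = (1 - p) * c * (p * (d * y)) := by rw [← hpd]; noncomm_ring
      _ = (1 - p) * c * p := by rw [← hp, hpp]
  have hpc : p * c = c * p := by
    rw [mul_sub, mul_one, sub_eq_zero] at h1
    rw [sub_mul, sub_mul, one_mul, sub_eq_zero] at h2
    rw [h1, h2]
  have hyp : y * p = y := by rw [hp, ← mul_assoc, ho]
  have hpy : p * y = y := by rw [hdy, ho]
  symm
  calc y * c = y * p * c := by rw [hyp]
    _ = y * c * p := by rw [mul_assoc, hpc, mul_assoc]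
    _ = y * (c * d) * y := by rw [hp]; noncomm_ring
    _ = y * d * c * y := by rw [hcd]; noncomm_ring
    _ = p * c * y := by rw [← hdy]
    _ = c * y := by rw [hpc, mul_assoc, hpy]

/-! ### Cutting down by a commuting idempotent -/

/-- Removing the part of a commuting idempotent turns a partial inverse of `b - z` into one of
`b * p - z`. -/
theorem sub_smul_mul_inverse {b p y : A} {z : ℂ} (hz : z ≠ 0) (hp : p * p = p)
    (hbp : b * p = p * b) (hyp : y * p = p * y) :
    (b * p - algebraMap ℂ A z) * (y * p - algebraMap ℂ A z⁻¹ * (1 - p)) =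
      (b - algebraMap ℂ A z) * y * p + (1 - p) ∧
    (y * p - algebraMap ℂ A z⁻¹ * (1 - p)) * (b * p - algebraMap ℂ A z) =
      y * (b - algebraMap ℂ A z) * p + (1 - p) := by
  have hzz : z * z⁻¹ = 1 := mul_inv_cancel₀ hz
  have e1 : b * p * (y * p) = b * y * p := by
    rw [mul_assoc, ← mul_assoc p, ← hyp, mul_assoc y, hp, mul_assoc]
  have e2 : y * p * (b * p) = y * b * p := by
    rw [mul_assoc, ← mul_assoc p, ← hbp, mul_assoc b, hp, mul_assoc]
  have e3 : b * p * (1 - p) = 0 := by rw [mul_assoc, mul_sub, hp]; simp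
  have e4 : (1 - p) * (b * p) = 0 := by rw [hbp, ← mul_assoc, sub_mul, hp]; simp
  simp only [Algebra.algebraMap_eq_smul_one, smul_mul_assoc, one_mul]
  constructor
  · calc (b * p - z • (1 : A)) * (y * p - z⁻¹ • (1 - p))
        = b * p * (y * p) - z⁻¹ • (b * p * (1 - p)) - z • (y * p) + (z * z⁻¹) • (1 - p) := by
          rw [sub_mul, mul_sub, smul_one_mul, mul_smul_comm, smul_sub, smul_smul]; abel
      _ = _ := by
          rw [e1, e3, hzz, sub_mul, sub_mul, smul_one_mul, smul_mul_assoc]; simp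
  · calc (y * p - z⁻¹ • (1 - p)) * (b * p - z • (1 : A))
        = y * p * (b * p) - z⁻¹ • ((1 - p) * (b * p)) - z • (y * p) + (z * z⁻¹) • (1 - p) := by
          rw [mul_sub, sub_mul, mul_smul_one, smul_mul_assoc, smul_sub, smul_smul]; abel
      _ = _ := by
          rw [e2, e4, hzz, mul_sub, sub_mul, mul_smul_one, smul_mul_assoc]; simp

theorem isUnit_mul_idempotent_sub {b p y : A} {z : ℂ} (hz : z ≠ 0) (hp : p * p = p)
    (hbp : b * p = p * b) (hyp : y * p = p * y)
    (h1 : (b - algebraMap ℂ A z) * y * p = p) (h2 : y * (b - algebraMap ℂ A z) * p = p) :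
    IsUnit (b * p - algebraMap ℂ A z) := by
  obtain ⟨e1, e2⟩ := sub_smul_mul_inverse hz hp hbp hyp
  refine ⟨⟨_, y * p - algebraMap ℂ A z⁻¹ * (1 - p), ?_, ?_⟩, rfl⟩
  · rw [e1, h1]; simp
  · rw [e2, h2]; simp

theorem IsUnit.mul_idempotent_sub {b p : A} {z : ℂ} (h : IsUnit (b - algebraMap ℂ A z))
    (hz : z ≠ 0) (hp : p * p = p) (hbp : b * p = p * b) :
    IsUnit (b * p - algebraMap ℂ A z) := by
  obtain ⟨u, hu⟩ := h
  have hc : Commute p (u : A) := by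
    rw [hu]
    exact Commute.sub_right hbp.symm (Algebra.commutes z p).symm
  refine isUnit_mul_idempotent_sub (y := ↑u⁻¹) hz hp hbp hc.units_inv_right.symm.eq ?_ ?_
  · rw [← hu]; simp
  · rw [← hu]; simp

theorem IsQuasinilpotentElem.mul_idempotent [CompleteSpace A] {b p : A}
    (h : IsQuasinilpotentElem b) (hp : p * p = p) (hbp : b * p = p * b) :
    IsQuasinilpotentElem (b * p) :=
  have := h.nontrivial
  isQuasinilpotentElem_of_isUnit_sub fun _ hz => (h.isUnit_sub hz).mul_idempotent_sub hz hp hbp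

theorem IsAccElem.mul_idempotent [CompleteSpace A] {b p : A} (h : IsAccElem b) (hp : p * p = p)
    (hbp : b * p = p * b) : IsAccElem (b * p) := by
  intro z hz
  obtain ⟨y, hy⟩ := h z hz
  have hpd : Commute p (b - algebraMap ℂ A z) :=
    Commute.sub_right hbp.symm (Algebra.commutes z p).symm
  have hpy : Commute p y := hy.commute hpd
  obtain ⟨e1, e2⟩ := sub_smul_mul_inverse hz hp hbp hpy.symm.eq
  obtain ⟨hdy, ho, hq⟩ := hy
  set d := b - algebraMap ℂ A z with hd
  -- On `1 - p` the element `b * p - z` is the scalar `-z`, so `w` is `y` on `p` and `-z⁻¹` on `1 -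
  -- p`.
  set w := y * p - algebraMap ℂ A z⁻¹ * (1 - p) with hw
  have hbz : b * p - algebraMap ℂ A z = d * p - algebraMap ℂ A z * (1 - p) := by
    rw [hd]; noncomm_ring
  have hpp0 : p * (1 - p) = 0 := by rw [mul_sub, hp]; simp
  have hpp1 : (1 - p) * (1 - p) = 1 - p := by rw [sub_mul, hpp0]; simp
  have hcw : (1 - p) * y * p = 0 := by
    rw [mul_assoc, ← hpy.eq, ← mul_assoc, sub_mul, hp]; simp
  have hcd : (1 - p) * d * p = 0 := by
    rw [mul_assoc, ← hpd.eq, ← mul_assoc, sub_mul, hp]; simp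
  refine ⟨w, ?_, ?_, ?_⟩
  · rw [e1, e2, hdy]
  · rw [e2]
    have k1 : y * d * p * (y * p) = y * p := by
      calc y * d * p * (y * p) = y * d * (p * y) * p := by noncomm_ring
        _ = y * d * y * (p * p) := by rw [hpy.eq]; noncomm_ring
        _ = y * p := by rw [ho, hp]
    calc (y * d * p + (1 - p)) * w
        = y * d * p * (y * p) + (1 - p) * y * p
          - (y * d * p + (1 - p)) * algebraMap ℂ A z⁻¹ * (1 - p) := by rw [hw]; noncomm_ring
      _ = y * p - algebraMap ℂ A z⁻¹ * (y * d * (p * (1 - p)) + (1 - p) * (1 - p)) := by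
          rw [k1, hcw, ← Algebra.commutes]; noncomm_ring
      _ = w := by rw [hpp0, hpp1, hw]; simp
  · have : b * p - algebraMap ℂ A z - (b * p - algebraMap ℂ A z) ^ 2 * w
        = (d - d ^ 2 * y) * p := by
      rw [pow_two, mul_assoc, e1, hbz]
      have k1 : d * p * (d * y * p) = d ^ 2 * y * p := by
        calc d * p * (d * y * p) = d * (p * d) * y * p := by noncomm_ring
          _ = d * d * (p * y) * p := by rw [hpd.eq]; noncomm_ring
          _ = d * d * y * (p * p) := by rw [hpy.eq]; noncomm_ring
          _ = d ^ 2 * y * p := by rw [hp]; noncomm_ring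
      have k2 : (1 - p) * (d * y * p) = 0 := by
        calc (1 - p) * (d * y * p) = (1 - p) * d * (y * p) := by noncomm_ring
          _ = (1 - p) * d * p * y := by rw [← hpy.eq]; noncomm_ring
          _ = 0 := by rw [hcd, zero_mul]
      calc d * p - algebraMap ℂ A z * (1 - p)
            - (d * p - algebraMap ℂ A z * (1 - p)) * (d * y * p + (1 - p))
          = d * p - algebraMap ℂ A z * (1 - p) - (d * p * (d * y * p) + d * (p * (1 - p))
            - algebraMap ℂ A z * ((1 - p) * (d * y * p))
            - algebraMap ℂ A z * ((1 - p) * (1 - p))) := by noncomm_ring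
        _ = (d - d ^ 2 * y) * p := by rw [k1, k2, hpp0, hpp1]; noncomm_ring
    rw [this]
    refine hq.mul_idempotent hp ?_
    have : Commute p (d - d ^ 2 * y) := hpd.sub_right ((hpd.pow_right 2).mul_right hpy)
    exact this.symm

/-! ### Induction on the spectrum -/

theorem isGDrazinInvertible_of_isAccElem_of_finite [CompleteSpace A] (s : Finset ℂ) :
    ∀ b : A, IsAccElem b → spectrum ℂ b ⊆ insert 0 (s : Set ℂ) → IsGDrazinInvertible b := by
  induction s using Finset.induction_on with
  | empty =>
    intro b hb hs
    -- The point `1` is arbitrary: only nontriviality of `A` is needed, so that the spectrum is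
    -- nonempty.
    have := (hb 1 one_ne_zero).nontrivial
    refine IsQuasinilpotentElem.isGDrazinInvertible ?_
    exact (spectrum.nonempty b).subset_singleton_iff.1 (by simpa using hs)
  | insert l s hl ih =>
    intro b hb hs
    rcases eq_or_ne l 0 with rfl | hl0
    · exact ih b hb (by simpa using hs)
    obtain ⟨y, hdy, ho, hq⟩ := hb l hl0
    set d := b - algebraMap ℂ A l with hd
    have hbd : b = d + algebraMap ℂ A l := by rw [hd]; simp
    set p := d * y with hp
    have hpd : p * d = d * p := by rw [hp, mul_assoc, ← hdy]
    have hpp : p * p = p := by rw [hp, mul_assoc, ← mul_assoc y, ho]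
    have hyp : y * p = y := by rw [hp, ← mul_assoc, ho]
    have hpy : p * y = y := by rw [hdy, ho]
    have hbp : b * p = p * b := by rw [hbd, add_mul, mul_add, hpd, Algebra.commutes]
    have hg : IsGDrazinInvertible (b * p) := by
      refine ih _ (hb.mul_idempotent hpp hbp) fun z hz => ?_
      by_contra hzs
      simp only [Set.mem_insert_iff, Finset.mem_coe, not_or] at hzs
      refine hz ?_
      suffices IsUnit (b * p - algebraMap ℂ A z) from
        spectrum.mem_resolventSet_iff.2 (by simpa using this.neg)
      -- At `l`, `y` inverts `d` on `p`; at any other such `z`, `b - z` is already a unit.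
      rcases eq_or_ne z l with rfl | hzl
      · refine isUnit_mul_idempotent_sub (y := y) hl0 hpp hbp (by rw [hyp, hpy]) ?_ ?_
        · rw [← hd, ← hp, hpp]
        · rw [← hd, ← hdy, hpp]
      · refine IsUnit.mul_idempotent_sub ?_ hzs.1 hpp hbp
        have : z ∉ spectrum ℂ b := fun h => by
          have := hs h
          simp [hzs.1, hzs.2, hzl] at this
        rw [spectrum.notMem_iff] at this
        simpa using this.neg
    have hu : d - d ^ 2 * y = d * (1 - p) := by rw [hp]; noncomm_ring
    rw [hu] at hq
    -- The unit `v = d * (1 - p) + l` agrees with `b` on `1 - p`, so `v⁻¹ * (1 - p)` inverts `b`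
    -- there and leaves the remainder `b * p`.
    obtain ⟨v, hv⟩ := hq.isUnit_sub (neg_ne_zero.2 hl0)
    rw [map_neg, sub_neg_eq_add] at hv
    have hqq : (1 - p) * (1 - p) = 1 - p := by
      rw [mul_sub, sub_mul _ _ p, hpp]; simp
    have hvq : (v : A) * (1 - p) = b * (1 - p) := by
      rw [hv, hbd, add_mul, add_mul, mul_assoc, hqq]
    have hdq : Commute d (1 - p) := Commute.sub_right (Commute.one_right d) hpd.symm
    have hlc (c : A) : Commute c (algebraMap ℂ A l) := (Algebra.commutes l c).symm
    have hqv : Commute (1 - p) (v : A) := by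
      rw [hv]
      exact (hdq.symm.mul_right (Commute.refl _)).add_right (hlc _)
    have hbq : Commute b (1 - p) := by
      rw [hbd]
      exact hdq.add_left (hlc _).symm
    have hbv : Commute b (v : A) := by
      have hbd' : Commute b d := by
        rw [hbd]; exact (Commute.refl d).add_left (hlc d).symm
      rw [hv]
      exact (hbd'.mul_right hbq).add_right (hlc b)
    have hqi := hqv.units_inv_right
    have hbi := hbv.units_inv_right
    have hbx : b * ((↑v⁻¹ : A) * (1 - p)) = 1 - p := by
      rw [← mul_assoc, hbi.eq, mul_assoc, ← hvq, ← mul_assoc]; simp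
    refine IsEGDrazinInverse.isGDrazinInvertible (x := (↑v⁻¹ : A) * (1 - p)) ⟨?_, ?_, ?_⟩
    · exact (hbi.mul_right hbq).eq
    · rw [mul_assoc, hbx, mul_assoc, hqq]
    · have : b - b ^ 2 * ((↑v⁻¹ : A) * (1 - p)) = b * p := by
        rw [pow_two, mul_assoc, hbx]; noncomm_ring
      rw [this]; exact hg

end

theorem mainTheorem5 {A : Type*} [NormedRing A] [NormedAlgebra ℂ A] [CompleteSpace A] (a : A) :
    List.TFAE
      [∃ x : A, IsAGDrazinInverse a x ∧ (spectrum ℂ (a - a ^ 2 * x)).Finite,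
       IsEGDrazinInvertible a,
       IsGDrazinInvertible a] := by
  tfae_have 1 → 2 := by
    rintro ⟨x, hx, hf⟩
    exact ⟨x, hx.comm, hx.outer, isGDrazinInvertible_of_isAccElem_of_finite hf.toFinset _ hx.acc
      (by simp)⟩
  tfae_have 2 → 3 := fun ⟨_, hx⟩ => hx.isGDrazinInvertible
  tfae_have 3 → 1 := by
    rintro ⟨x, hx⟩
    refine ⟨x, ⟨hx.comm, hx.outer, hx.qnil.isAccElem⟩, ?_⟩
    rw [show spectrum ℂ (a - a ^ 2 * x) = {0} from hx.qnil]
    exact Set.finite_singleton 0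
  tfae_finish
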